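/- Let $H$ be the $7$-dimensional Heisenberg group, with left-invariant coframe $e^1,\dots,e^7$ satisfying $de^i=0$ for $i\le 6$ and $de^7=e^{12}+e^{34}+e^{56}$ (where $e^{ij}=e^i\wedge e^j$, etc.), and let $$\varphi_0=e^{127}+e^{347}+e^{567}+e^{135}-e^{146}-e^{236}-e^{245}.$$ Let $I\subseteq\mathbb R$ be an interval of positive length containing $0$, let $f,a,b,c$ be nowhere-vanishing real functions on $I$ with $a(0),b(0),c(0)>0$, and consider the family of left-invariant $\mathrm G_2$-structures $$\varphi_t=f\,(a^2e^{127}+b^2e^{347}+c^2e^{567})+abc\,(e^{135}-e^{146}-e^{236}-e^{245}),\qquad t\in I,$$ the functions being evaluated at $t$. Each $\mathrm G_2$-structure $\varphi$ determines a Riemannian metric $g$ and a volume form by $(X\lrcorner\varphi)\wedge(Y\lrcorner\varphi)\wedge\varphi=6\,g(X,Y)\,\mathrm{vol}$, the dual $4$-form $\psi=*\varphi$, and the torsion $2$-tensor $T$ by $\nabla_m\varphi_{ijk}=T_m{}^p\psi_{pijk}$, where $\nabla$ is the Levi-Civita connection of $g$. For a $2$-tensor $A$ put $(A\diamond\varphi)_{ijk}=A_i{}^p\varphi_{pjk}+A_j{}^p\varphi_{ipk}+A_k{}^p\varphi_{ijp}$,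 and let $(\operatorname{Div}T)_i=\nabla^jT_{ji}$. Then $\varphi_t$ is a solution on $I$ of the Ricci-harmonic flow $$\frac{\partial\varphi}{\partial t}=\bigl(-\mathrm{Ric}+3T^tT-|T|^2g\bigr)\diamond\varphi+\operatorname{Div}T\lrcorner\psi,\qquad \varphi(0)=\varphi_0,$$ if and only if $f(0)=a(0)=b(0)=c(0)=1$ and, at every $t\in I$, the functions $fa^2$, $fb^2$, $fc^2$, $abc$ are differentiable with $$\begin{aligned} \frac{d(fa^2)}{dt}&=-\frac{f^3\bigl(4a^4(b^4+c^4)-b^4c^4\bigr)}{2a^2b^4c^4},\\ \frac{d(fb^2)}{dt}&=-\frac{f^3\bigl(4b^4(a^4+c^4)-a^4c^4\bigr)}{2a^4b^2c^4},\\ \frac{d(fc^2)}{dt}&=-\frac{f^3\bigl(4c^4(a^4+b^4)-a^4b^4\bigr)}{2a^4b^4c^2},\\ \frac{d(abc)}{dt}&=-\frac{f^2\bigl(3(abc)^2(a^2+b^2+c^2)+2(a^4b^4+a^4c^4+b^4c^4)\bigr)}{2a^3b^3c^3}. \end{aligned}$$ (Derivatives at an endpoint of $I$ that belongs to $I$ are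 one-sided.) -/

import Mathlib

open scoped ContDiff

noncomputable section

namespace HeisenbergG2

/-! ## The 7-dimensional Heisenberg group

It is `ℝ⁷` with the group law
`x * y = x + y - (x₁ y₂ + x₃ y₄ + x₅ y₆) ∂₇`. Coordinates, and all tensor indices below, are
numbered `0, …, 6` instead of `1, …, 7`. As a manifold it has the single global chart `ℝ⁷`, so that
its tangent spaces are identified with `ℝ⁷`. -/

/-- The underlying manifold `ℝ⁷` of the Heisenberg group. -/
def Heis : Type := Fin 7 → ℝ

instance : NormedAddCommGroup Heis := inferInstanceAs (NormedAddCommGroup (Fin 7 → ℝ))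
instance : NormedSpace ℝ Heis := inferInstanceAs (NormedSpace ℝ (Fin 7 → ℝ))
instance : FiniteDimensional ℝ Heis := inferInstanceAs (FiniteDimensional ℝ (Fin 7 → ℝ))

/-- The `i`-th coordinate, as a linear functional. -/
def coord (i : Fin 7) : Heis →L[ℝ] ℝ := ContinuousLinearMap.proj (R := ℝ) (φ := fun _ : Fin 7 => ℝ) i

/-- The `i`-th standard basis vector of `ℝ⁷`. -/
def basisVec (i : Fin 7) : Heis := (Pi.single i 1 : Fin 7 → ℝ)

/-- The bilinear form `x₁ y₂ + x₃ y₄ + x₅ y₆` of the group law. -/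
def heisForm (x y : Heis) : ℝ := x 0 * y 1 + x 2 * y 3 + x 4 * y 5

instance : Mul Heis := ⟨fun x y i => x i + y i - if i = 6 then heisForm x y else 0⟩
instance : One Heis := ⟨fun _ => 0⟩
instance : Inv Heis := ⟨fun x i => - x i - if i = 6 then heisForm x x else 0⟩

theorem mul_apply (x y : Heis) (i : Fin 7) :
    (x * y) i = x i + y i - if i = 6 then heisForm x y else 0 := rfl
theorem one_apply (i : Fin 7) : (1 : Heis) i = 0 := rfl
theorem inv_apply (x : Heis) (i : Fin 7) :
    x⁻¹ i = - x i - if i = 6 then heisForm x x else 0 := rfl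

instance : Group Heis :=
  Group.ofLeftAxioms
    (fun x y z => by
      funext i
      by_cases h : i = 6
      · subst h
        simp [mul_apply, heisForm]
        ring
      · simp [mul_apply, h]
        ring)
    (fun x => by
      funext i
      by_cases h : i = 6
      · subst h
        simp [mul_apply, one_apply, heisForm]
      · simp [mul_apply, one_apply, h])
    (fun x => by
      funext i
      by_cases h : i = 6
      · subst h
        simp [mul_apply, one_apply, inv_apply, heisForm]
        ring
      · simp [mul_apply, one_apply, inv_apply, h])

/-- The left-invariant frame: `eᵢ(x) = d(L_x)₁ (∂ᵢ)`, where `L_x` is left translation by `x`. -/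
def frame (i : Fin 7) (x : Heis) : Heis := fderiv ℝ (fun y : Heis => x * y) 1 (basisVec i)

/-- The left-invariant coframe `eⁱ`, dual to `frame`:
`eⁱ(x)(v)` is the `i`-th coordinate of `d(L_{x⁻¹})_x (v)`. -/
def coframe (i : Fin 7) (x : Heis) : Heis →ₗ[ℝ] ℝ :=
  ((coord i).comp (fderiv ℝ (fun y : Heis => x⁻¹ * y) x) : Heis →L[ℝ] ℝ).toLinearMap

/-- Derivative of the function `u` in the direction of the `i`-th frame field. -/
def frameDeriv (i : Fin 7) (u : Heis → ℝ) (x : Heis) : ℝ := fderiv ℝ u x (frame i x)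

/-- Structure functions of the frame: `[eᵢ, eⱼ] = ∑ₖ cᵢⱼᵏ eₖ`. -/
def structFun (i j k : Fin 7) (x : Heis) : ℝ :=
  coframe k x (VectorField.lieBracket ℝ (frame i) (frame j) x)

theorem hasFDerivAt_mul_left (x z : Heis) :
    HasFDerivAt (fun y : Heis => x * y)
      (ContinuousLinearMap.id ℝ Heis -
        (x 0 • coord 1 + x 2 • coord 3 + x 4 • coord 5).smulRight (basisVec 6)) z := by
  have h : (fun y : Heis => x * y) = fun y : Heis => x + (ContinuousLinearMap.id ℝ Heis -
        (x 0 • coord 1 + x 2 • coord 3 + x 4 • coord 5).smulRight (basisVec 6)) y := by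
    funext y i
    change x i + y i - (if i = 6 then heisForm x y else 0) =
      x i + (y i - (x 0 * y 1 + x 2 * y 3 + x 4 * y 5) * (Pi.single 6 1 : Fin 7 → ℝ) i)
    by_cases h : i = 6 <;> simp [h, heisForm]
    ring
  rw [h]
  exact (ContinuousLinearMap.hasFDerivAt _).const_add x

theorem frame_eq (i : Fin 7) (x : Heis) :
    frame i x = basisVec i - (coord 0 x * coord 1 (basisVec i) + coord 2 x * coord 3 (basisVec i)
      + coord 4 x * coord 5 (basisVec i)) • basisVec 6 := by
  rw [frame, (hasFDerivAt_mul_left x 1).fderiv]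
  rfl

/-- `eⁱ = dxⁱ` for the first six indices and `e⁷ = dx⁷ + x₁ dx² + x₃ dx⁴ + x₅ dx⁶`. -/
theorem coframe_apply (i : Fin 7) (x v : Heis) :
    coframe i x v = v i + if i = 6 then x 0 * v 1 + x 2 * v 3 + x 4 * v 5 else 0 := by
  have h : coframe i x v = v i - (x⁻¹ 0 * v 1 + x⁻¹ 2 * v 3 + x⁻¹ 4 * v 5) *
      (Pi.single 6 1 : Fin 7 → ℝ) i := by
    rw [coframe, (hasFDerivAt_mul_left x⁻¹ x).fderiv]
    rfl
  rw [h]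
  by_cases h : i = 6 <;> simp [h, inv_apply]
  ring

/-! ## Tensor fields

A tensor field on the group is given either as a field of multilinear maps or by its components,
which are functions on the group, in the left-invariant frame. -/

/-- Fields of alternating 3-forms. -/
abbrev ThreeForm : Type := Heis → Heis [⋀^Fin 3]→ₗ[ℝ] ℝ

/-- The 3-form `eⁱ ∧ eʲ ∧ eᵏ`. -/
def wedge3 (i j k : Fin 7) : ThreeForm := fun x =>
  (Matrix.detRowAlternating (n := Fin 3) (R := ℝ)).compLinearMap
    (LinearMap.pi ![coframe i x, coframe j x, coframe k x])

/-- The components `φᵢⱼₖ = φ(eᵢ, eⱼ, eₖ)` of a 3-form. -/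
def comp (φ : ThreeForm) (i j k : Fin 7) (x : Heis) : ℝ := φ x ![frame i x, frame j x, frame k x]

/-- Components `gᵢⱼ` of a metric in the frame. -/
abbrev MetricField : Type := Heis → Matrix (Fin 7) (Fin 7) ℝ

/-- Components `Tᵢⱼ` of a covariant 2-tensor in the frame. -/
abbrev TwoTensor : Type := Fin 7 → Fin 7 → Heis → ℝ

/-- The coefficient of `e¹ ∧ ⋯ ∧ e⁷` in `(eᵢ ⌟ φ) ∧ (eⱼ ⌟ φ) ∧ φ`. For forms `α`, `β`, `γ` of degrees
2, 2, 3 the coefficient in `α ∧ β ∧ γ` is the alternating sum below divided by `2! 2! 3! = 24`. -/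
def contractionForm (φ : ThreeForm) (i j : Fin 7) (x : Heis) : ℝ :=
  (1 / 24) * ∑ σ : Equiv.Perm (Fin 7), ((Equiv.Perm.sign σ : ℤ) : ℝ) *
    (comp φ i (σ 0) (σ 1) x * comp φ j (σ 2) (σ 3) x * comp φ (σ 4) (σ 5) (σ 6) x)

/-- `φ` is a (smooth) G₂-structure, with associated metric `g` and associated volume form
`vol = v e¹ ∧ ⋯ ∧ e⁷`: `(X ⌟ φ) ∧ (Y ⌟ φ) ∧ φ = 6 g(X, Y) vol`, where `g` is a Riemannian metric and
`vol` is one of its two volume forms. -/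
structure IsG2Structure (φ : ThreeForm) (g : MetricField) (v : Heis → ℝ) : Prop where
  smooth : ∀ i j k, ContDiff ℝ ∞ (comp φ i j k)
  posDef : ∀ x, (g x).PosDef
  vol_sq : ∀ x, v x ^ 2 = (g x).det
  contraction : ∀ i j x, contractionForm φ i j x = 6 * g x i j * v x

/-- The Levi-Civita symbol: the sign of `s` if `s` is a permutation, and `0` otherwise. -/
def leviCivita (s : Fin 7 → Fin 7) : ℝ :=
  ((1 : Matrix (Fin 7) (Fin 7) ℝ).submatrix s id).det

/-- Components of the Hodge dual `ψ = *φ`: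
`ψᵢⱼₖₗ = (1/3!) φᵃᵇᶜ vol_{abcijkl}`, indices raised with `g`. -/
def hodgeDual (g : MetricField) (v : Heis → ℝ) (φ : ThreeForm) (i j k l : Fin 7) (x : Heis) : ℝ :=
  (1 / 6) * ∑ a, ∑ b, ∑ c,
    (∑ p, ∑ q, ∑ r, (g x)⁻¹ a p * (g x)⁻¹ b q * (g x)⁻¹ c r * comp φ p q r x) *
      (v x * leviCivita ![a, b, c, i, j, k, l])

/-- Coefficients of the Levi-Civita connection of `g`, `∇_{eᵢ} eⱼ = ∑ₗ Γᵢⱼˡ eₗ`, given by the Koszul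
formula `2 g(∇_X Y, Z) = X g(Y,Z) + Y g(X,Z) - Z g(X,Y) + g([X,Y],Z) - g([X,Z],Y) - g([Y,Z],X)`. -/
def connection (g : MetricField) (i j l : Fin 7) (x : Heis) : ℝ :=
  ∑ k, (g x)⁻¹ l k * ((1 / 2) *
    (frameDeriv i (fun y => g y j k) x + frameDeriv j (fun y => g y i k) x
      - frameDeriv k (fun y => g y i j) x
      + ∑ p, (structFun i j p x * g x p k - structFun i k p x * g x p j
          - structFun j k p x * g x p i)))

/-- `(∇ₘ φ)ᵢⱼₖ`, the components of the covariant derivative of a 3-form. -/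
def covDeriv3 (g : MetricField) (φ : ThreeForm) (m i j k : Fin 7) (x : Heis) : ℝ :=
  frameDeriv m (comp φ i j k) x
    - ∑ p, (connection g m i p x * comp φ p j k x + connection g m j p x * comp φ i p k x
        + connection g m k p x * comp φ i j p x)

/-- `(∇ₘ T)ᵢⱼ`, the components of the covariant derivative of a 2-tensor. -/
def covDeriv2 (g : MetricField) (T : TwoTensor) (m i j : Fin 7) (x : Heis) : ℝ :=
  frameDeriv m (T i j) x
    - ∑ p, (connection g m i p x * T p j x + connection g m j p x * T i p x)

/-- Components `R(eᵢ, eⱼ)eₖ = ∑ₗ Rᵢⱼₖˡ eₗ` of the Riemann curvature,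
`R(X,Y)Z = ∇_X ∇_Y Z - ∇_Y ∇_X Z - ∇_{[X,Y]} Z`. -/
def riemann (g : MetricField) (i j k l : Fin 7) (x : Heis) : ℝ :=
  frameDeriv i (connection g j k l) x - frameDeriv j (connection g i k l) x
    + ∑ p, (connection g j k p x * connection g i p l x
        - connection g i k p x * connection g j p l x
        - structFun i j p x * connection g p k l x)

/-- The Ricci tensor `Ric(Y, Z) = tr (X ↦ R(X, Y)Z)`. -/
def ricci (g : MetricField) : TwoTensor := fun j k x => ∑ i, riemann g i j k i x

/-- `T` is the full torsion tensor of the G₂-structure `φ`: `∇ₘ φᵢⱼₖ = Tₘᵖ ψₚᵢⱼₖ`. -/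
def IsTorsion (g : MetricField) (v : Heis → ℝ) (φ : ThreeForm) (T : TwoTensor) : Prop :=
  ∀ m i j k x, covDeriv3 g φ m i j k x =
    ∑ p, (∑ q, T m q x * (g x)⁻¹ q p) * hodgeDual g v φ p i j k x

/-- `(Tᵗ T)ᵢⱼ = Tₖᵢ gᵏˡ Tₗⱼ`. -/
def transposeMul (g : MetricField) (T : TwoTensor) : TwoTensor := fun i j x =>
  ∑ k, ∑ l, T k i x * (g x)⁻¹ k l * T l j x

/-- `|T|² = Tᵢⱼ Tᵢⱼ`, indices contracted with `g`. -/
def normSq (g : MetricField) (T : TwoTensor) (x : Heis) : ℝ :=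
  ∑ i, ∑ j, ∑ k, ∑ l, (g x)⁻¹ i k * (g x)⁻¹ j l * T i j x * T k l x

/-- `(Div T)ᵢ = ∇ʲ Tⱼᵢ`. -/
def divergence (g : MetricField) (T : TwoTensor) (i : Fin 7) (x : Heis) : ℝ :=
  ∑ j, ∑ m, (g x)⁻¹ j m * covDeriv2 g T m j i x

/-- `(A ⋄ φ)ᵢⱼₖ = Aᵢᵖ φₚⱼₖ + Aⱼᵖ φᵢₚₖ + Aₖᵖ φᵢⱼₚ`. -/
def diamond (g : MetricField) (A : TwoTensor) (φ : ThreeForm) (i j k : Fin 7) (x : Heis) : ℝ :=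
  ∑ p, ((∑ q, A i q x * (g x)⁻¹ q p) * comp φ p j k x
    + (∑ q, A j q x * (g x)⁻¹ q p) * comp φ i p k x
    + (∑ q, A k q x * (g x)⁻¹ q p) * comp φ i j p x)

/-- The tensor `-Ric + 3 Tᵗ T - |T|² g`. -/
def flowTensor (g : MetricField) (T : TwoTensor) : TwoTensor := fun i j x =>
  - ricci g i j x + 3 * transposeMul g T i j x - normSq g T x * g x i j

/-- Components of `(-Ric + 3 Tᵗ T - |T|² g) ⋄ φ + Div T ⌟ ψ`. -/
def flowVelocity (g : MetricField) (v : Heis → ℝ) (φ : ThreeForm) (T : TwoTensor)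
    (i j k : Fin 7) (x : Heis) : ℝ :=
  diamond g (flowTensor g T) φ i j k x
    + ∑ p, (∑ q, divergence g T q x * (g x)⁻¹ q p) * hodgeDual g v φ p i j k x

/-- `φ` is a solution on the time set `I` of the Ricci-harmonic flow with initial value `φ₀`. The
metric `g`, the volume form `v` and the torsion `T` are determined by `φ t`. -/
def SolvesRicciHarmonicFlow (I : Set ℝ) (φ₀ : ThreeForm) (φ : ℝ → ThreeForm) : Prop :=
  φ 0 = φ₀ ∧ ∀ t ∈ I, ∃ (g : MetricField) (v : Heis → ℝ) (T : TwoTensor),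
    IsG2Structure (φ t) g v ∧ IsTorsion g v (φ t) T ∧
      ∀ i j k x, HasDerivWithinAt (fun s => comp (φ s) i j k x)
        (flowVelocity g v (φ t) T i j k x) I t

/-! ## The left-invariant family -/

/-- `e¹²⁷ + e³⁴⁷ + e⁵⁶⁷ + e¹³⁵ - e¹⁴⁶ - e²³⁶ - e²⁴⁵`. -/
def standardForm : ThreeForm :=
  wedge3 0 1 6 + wedge3 2 3 6 + wedge3 4 5 6
    + wedge3 0 2 4 - wedge3 0 3 5 - wedge3 1 2 5 - wedge3 1 3 4

/-- `f (a² e¹²⁷ + b² e³⁴⁷ + c² e⁵⁶⁷) + a b c (e¹³⁵ - e¹⁴⁶ - e²³⁶ - e²⁴⁵)` at each time. -/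
def ansatz (f a b c : ℝ → ℝ) (t : ℝ) : ThreeForm :=
  f t • (a t ^ 2 • wedge3 0 1 6 + b t ^ 2 • wedge3 2 3 6 + c t ^ 2 • wedge3 4 5 6)
    + (a t * b t * c t) • (wedge3 0 2 4 - wedge3 0 3 5 - wedge3 1 2 5 - wedge3 1 3 4)

/-- The system of four ordinary differential equations, on the time set `I`. -/
def SolvesODE (I : Set ℝ) (f a b c : ℝ → ℝ) : Prop :=
  ∀ t ∈ I,
    HasDerivWithinAt (fun s => f s * a s ^ 2)
      (-(f t ^ 3 * (4 * a t ^ 4 * (b t ^ 4 + c t ^ 4) - b t ^ 4 * c t ^ 4)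
        / (2 * a t ^ 2 * b t ^ 4 * c t ^ 4))) I t ∧
    HasDerivWithinAt (fun s => f s * b s ^ 2)
      (-(f t ^ 3 * (4 * b t ^ 4 * (a t ^ 4 + c t ^ 4) - a t ^ 4 * c t ^ 4)
        / (2 * a t ^ 4 * b t ^ 2 * c t ^ 4))) I t ∧
    HasDerivWithinAt (fun s => f s * c s ^ 2)
      (-(f t ^ 3 * (4 * c t ^ 4 * (a t ^ 4 + b t ^ 4) - a t ^ 4 * b t ^ 4)
        / (2 * a t ^ 4 * b t ^ 4 * c t ^ 2))) I t ∧
    HasDerivWithinAt (fun s => a s * b s * c s)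
      (-(f t ^ 2 * (3 * (a t * b t * c t) ^ 2 * (a t ^ 2 + b t ^ 2 + c t ^ 2)
          + 2 * (a t ^ 4 * b t ^ 4 + a t ^ 4 * c t ^ 4 + b t ^ 4 * c t ^ 4))
        / (2 * a t ^ 3 * b t ^ 3 * c t ^ 3))) I t

end HeisenbergG2

end

noncomputable section

namespace HeisenbergG2

/-! ## Integral symbols

Components of the model tensors with respect to an orthonormal frame, up to the scalars
`w = (f / a², f / b², f / c²)`; the index `u : Fin 3` stands for the coefficient of `w u`. -/

/-! At each time the rescaled coframe `s i • eⁱ`, with `s = (a, a, b, b, c, c, f)`, turns `φ` into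
the standard 3-form, and only three structure constants `w = (f / a², f / b², f / c²)` survive. Its
metric and volume form are therefore `∑ (s i • eⁱ)²` and `∏ s i` (so the orientation follows the
sign of `f`), and `φ` determines both (`eq_of_isG2Structure`).

In this coframe the connection is linear in `w` with half-integral coefficients, so each tensor
computation splits into finitely many integer identities, one per monomial in `w`, which the kernel
checks. They show that the torsion is diagonal and linear in `w` (`isTorsion_iff`), that Ricci is
diagonal and a combination of the `w u ^ 2` (`ricci_eq`), and that `Div T = 0`
(`divergence_eq_zero`).

Hence the velocity is `A ⋄ φ` with `A` diagonal, which multiplies each monomial of `φ` by the sum of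
three diagonal entries of `A`. These entries agree within the index pairs 01, 23, 45, so the
velocity stays in the span of the four forms of the ansatz (`diagScale_mul_phiSymbol`). Comparing
the four coefficients gives the differential system (`hasDerivWithinAt_comp_ansatz_iff`,
`flowDiag_velocities`). -/

/-- Kronecker delta. -/
def delta (i j : Fin 7) : ℤ := if i = j then 1 else 0

/-- Components of `eᵖ ∧ e^q ∧ eʳ`. -/
def wedgeSymbol (p q r i j k : Fin 7) : ℤ :=
  delta p i * (delta q j * delta r k - delta q k * delta r j)
    - delta p j * (delta q i * delta r k - delta q k * delta r i)
    + delta p k * (delta q i * delta r j - delta q j * delta r i)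

/-- Components of the standard 3-form. -/
def phiSymbol (i j k : Fin 7) : ℤ :=
  wedgeSymbol 0 1 6 i j k + wedgeSymbol 2 3 6 i j k + wedgeSymbol 4 5 6 i j k
    + (wedgeSymbol 0 2 4 i j k - wedgeSymbol 0 3 5 i j k - wedgeSymbol 1 2 5 i j k
      - wedgeSymbol 1 3 4 i j k)

/-- Components of the standard 4-form. -/
def psiSymbol (i j k l : Fin 7) : ℤ :=
  ∑ p, phiSymbol i j p * phiSymbol k l p - delta i k * delta j l + delta i l * delta j k

/-- Structure constants of the three brackets `[e₁, e₂]`, `[e₃, e₄]`, `[e₅, e₆]`. -/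
def structSymbol (u : Fin 3) (i j k : Fin 7) : ℤ :=
  delta 6 k *
    ![delta 0 j * delta 1 i - delta 0 i * delta 1 j,
      delta 2 j * delta 3 i - delta 2 i * delta 3 j,
      delta 4 j * delta 5 i - delta 4 i * delta 5 j] u

/-- Twice the coefficients of the Levi-Civita connection in an orthonormal frame. -/
def connSymbol (u : Fin 3) (i j l : Fin 7) : ℤ :=
  structSymbol u i j l - structSymbol u i l j - structSymbol u j l i

/-- Twice the diagonal of the torsion in an orthonormal frame. -/
def torsionSymbol (u : Fin 3) (i : Fin 7) : ℤ :=
  ![![1, 1, 0, 0, 0, 0, -1], ![0, 0, 1, 1, 0, 0, -1], ![0, 0, 0, 0, 1, 1, -1]] u i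

/-- Twice the diagonal of the Ricci tensor in an orthonormal frame. -/
def ricciSymbol (u : Fin 3) (i : Fin 7) : ℤ := -torsionSymbol u i

/-- The Levi-Civita symbol as an integer. -/
def leviSymbol (s : Fin 7 → Fin 7) : ℤ :=
  ∏ i, ∏ j ∈ Finset.Ioi i, if s i < s j then 1 else if s i = s j then 0 else -1

/-- The coefficient of `w u / 2` in `∇ₘ φᵢⱼₖ = Tₘᵖ ψₚᵢⱼₖ`. Both sides are linear in `w`, so the
three brackets can be treated one at a time. -/
theorem torsion_symbol_identity : ∀ (u : Fin 3) (m i j k : Fin 7),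
    -(∑ p, (connSymbol u m i p * phiSymbol p j k + connSymbol u m j p * phiSymbol i p k
      + connSymbol u m k p * phiSymbol i j p)) = torsionSymbol u m * psiSymbol m i j k := by
  decide +kernel

/-- The coefficient of `w u * w v / 4` in the Ricci tensor. The factor 2 appears because
`connSymbol` is twice the connection while `structSymbol` is not doubled. All mixed products of
distinct brackets cancel. -/
theorem ricci_symbol_identity : ∀ (u v : Fin 3) (j k : Fin 7),
    ∑ i, ∑ p, (connSymbol u j k p * connSymbol v i p i - connSymbol u i k p * connSymbol v j p i
      - 2 * (structSymbol u i j p * connSymbol v p k i)) =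
      if u = v ∧ j = k then 2 * ricciSymbol u j else 0 := by
  decide +kernel

theorem connSymbol_self_left : ∀ (u : Fin 3) (i j : Fin 7), connSymbol u i i j = 0 := by
  decide +kernel

theorem connSymbol_self_right : ∀ (u : Fin 3) (i j : Fin 7), connSymbol u i j i = 0 := by
  decide +kernel

theorem psiSymbol_eq_zero : ∀ i j k l : Fin 7,
    i = j ∨ i = k ∨ i = l ∨ j = k ∨ j = l ∨ k = l → psiSymbol i j k l = 0 := by
  decide +kernel

/-- The identity `*φ = ψ` for the standard form. The nested conditions discard vanishing terms
early, which keeps the kernel evaluation small. -/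
theorem sum_phi_mul_levi_aux : ∀ i j k l : Fin 7,
    ¬ (i = j ∨ i = k ∨ i = l ∨ j = k ∨ j = l ∨ k = l) →
    ∑ a, (if a = i ∨ a = j ∨ a = k ∨ a = l then 0 else
      ∑ b, (if b = i ∨ b = j ∨ b = k ∨ b = l then 0 else
        ∑ c, (if c = i ∨ c = j ∨ c = k ∨ c = l then 0 else
          if phiSymbol a b c = 0 then 0
          else phiSymbol a b c * leviSymbol ![a, b, c, i, j, k, l]))) =
      6 * psiSymbol i j k l := by
  decide +kernel

/-- The constant is `4 * 6`, from the contractions `φⱼcd ψabcd = 4 φⱼab` and `φᵢab φⱼab = 6 δᵢⱼ`. -/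
theorem sum_phi_mul_phi_mul_psi_aux : ∀ i j : Fin 7,
    ∑ a, ∑ b, (if phiSymbol i a b = 0 then 0 else ∑ c, ∑ d, (if phiSymbol j c d = 0 then 0
      else phiSymbol i a b * phiSymbol j c d * psiSymbol a b c d)) = 24 * delta i j := by
  decide +kernel

/-- Each index of the 4-form is determined by suitable values of the other three. -/
theorem exists_psiSymbol_eq_one : ∀ p : Fin 7, ∃ i j k, psiSymbol p i j k = 1 ∧
    ∀ q, q ≠ p → psiSymbol q i j k = 0 := by
  decide +kernel

/-! ## The Levi-Civita symbol -/

theorem leviSymbol_eq_zero {s : Fin 7 → Fin 7} (hs : ¬ Function.Injective s) :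
    leviSymbol s = 0 := by
  obtain ⟨i, j, hij, hlt⟩ : ∃ i j, s i = s j ∧ i < j := by
    simp only [Function.Injective, not_forall] at hs
    obtain ⟨i, j, hij, hne⟩ := hs
    rcases lt_or_gt_of_ne hne with h | h
    · exact ⟨i, j, hij, h⟩
    · exact ⟨j, i, hij.symm, h⟩
  exact Finset.prod_eq_zero (Finset.mem_univ i)
    (Finset.prod_eq_zero (Finset.mem_Ioi.2 hlt) (by simp [hij]))

theorem leviSymbol_perm (σ : Equiv.Perm (Fin 7)) :
    leviSymbol σ = (Equiv.Perm.sign σ : ℤ) := by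
  rw [Equiv.Perm.sign_eq_prod_prod_Ioi, leviSymbol]
  push_cast
  refine Finset.prod_congr rfl fun i _ => Finset.prod_congr rfl fun j hj => ?_
  have : σ i ≠ σ j := fun h => (Finset.mem_Ioi.1 hj).ne (σ.injective h)
  by_cases h : σ i < σ j <;> simp [h, this]

theorem exists_perm_of_leviSymbol_ne_zero {s : Fin 7 → Fin 7} (hs : leviSymbol s ≠ 0) :
    ∃ σ : Equiv.Perm (Fin 7), s = σ := by
  have h : Function.Injective s := by
    by_contra h
    exact hs (leviSymbol_eq_zero h)
  exact ⟨Equiv.ofBijective s (Finite.injective_iff_bijective.1 h), rfl⟩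

theorem leviCivita_eq (s : Fin 7 → Fin 7) : leviCivita s = leviSymbol s := by
  by_cases hs : Function.Injective s
  · have h : s = Equiv.ofBijective s (Finite.injective_iff_bijective.1 hs) := rfl
    rw [h, leviSymbol_perm, leviCivita, Matrix.det_permute, Matrix.det_one, mul_one]
  · rw [leviSymbol_eq_zero hs]
    simp only [Function.Injective, not_forall] at hs
    obtain ⟨i, j, hij, hne⟩ := hs
    rw [leviCivita, Matrix.det_zero_of_row_eq hne (show (1 : Matrix _ _ ℝ) (s i) = (1 : Matrix _ _ ℝ) (s j) by rw [hij])]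
    simp

theorem leviSymbol_comp_perm (s : Fin 7 → Fin 7) (τ : Equiv.Perm (Fin 7)) :
    leviSymbol (s ∘ τ) = (Equiv.Perm.sign τ : ℤ) * leviSymbol s := by
  by_cases hs : Function.Injective s
  · have h : s = Equiv.ofBijective s (Finite.injective_iff_bijective.1 hs) := rfl
    rw [h, leviSymbol_perm, ← Equiv.Perm.coe_mul, leviSymbol_perm, Equiv.Perm.sign_mul]
    push_cast
    ring
  · rw [leviSymbol_eq_zero hs, leviSymbol_eq_zero, mul_zero]
    exact fun h => hs ((Equiv.injective_comp τ s).1 h)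

/-- A cyclic permutation of seven letters is even. -/
theorem leviSymbol_rotate (a b c d e f g : Fin 7) :
    leviSymbol ![a, b, c, d, e, f, g] = leviSymbol ![e, f, g, a, b, c, d] := by
  have h : ![a, b, c, d, e, f, g] = ![e, f, g, a, b, c, d] ∘ (finRotate 7 ^ 3 : Equiv.Perm _) := by
    funext i
    fin_cases i <;> rfl
  rw [h, leviSymbol_comp_perm, map_pow, sign_finRotate]
  norm_num

theorem prod_mul_leviSymbol {R : Type*} [CommRing R] (s : Fin 7 → R) (t : Fin 7 → Fin 7) :
    (∏ i, s i) * (leviSymbol t : R) = (∏ i, s (t i)) * (leviSymbol t : R) := by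
  by_cases h : leviSymbol t = 0
  · simp [h]
  · obtain ⟨σ, rfl⟩ := exists_perm_of_leviSymbol_ne_zero h
    rw [Equiv.prod_comp]

theorem sum_sign_mul_eq_sum_leviSymbol_mul (F : (Fin 7 → Fin 7) → ℤ) :
    ∑ σ : Equiv.Perm (Fin 7), (Equiv.Perm.sign σ : ℤ) * F σ = ∑ s, leviSymbol s * F s := by
  refine Finset.sum_of_injOn (fun σ : Equiv.Perm (Fin 7) => (σ : Fin 7 → Fin 7))
    (DFunLike.coe_injective.injOn) (by simp) ?_ ?_
  · intro s _ hs
    by_cases h : leviSymbol s = 0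
    · simp [h]
    · obtain ⟨σ, rfl⟩ := exists_perm_of_leviSymbol_ne_zero h
      exact absurd ⟨σ, by simp, rfl⟩ hs
  · intro σ _
    rw [leviSymbol_perm]

theorem sum_vecCons {α M : Type*} [Fintype α] [AddCommMonoid M] {n : ℕ}
    (F : (Fin (n + 1) → α) → M) : ∑ s, F s = ∑ a, ∑ s : Fin n → α, F (Matrix.vecCons a s) := by
  rw [← (Fin.consEquiv fun _ => α).sum_comp, Fintype.sum_prod_type]
  rfl

theorem sum_phi_mul_levi (i j k l : Fin 7) :
    ∑ a, ∑ b, ∑ c, phiSymbol a b c * leviSymbol ![a, b, c, i, j, k, l] = 6 * psiSymbol i j k l := by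
  have hzero (m n : Fin 7) (hmn : m ≠ n) (a b c : Fin 7)
      (h : ![a, b, c, i, j, k, l] m = ![a, b, c, i, j, k, l] n) :
      leviSymbol ![a, b, c, i, j, k, l] = 0 :=
    leviSymbol_eq_zero fun hs => hmn (hs h)
  by_cases h : i = j ∨ i = k ∨ i = l ∨ j = k ∨ j = l ∨ k = l
  · rw [psiSymbol_eq_zero i j k l h, mul_zero]
    refine Finset.sum_eq_zero fun a _ => Finset.sum_eq_zero fun b _ =>
      Finset.sum_eq_zero fun c _ => ?_
    rw [show leviSymbol ![a, b, c, i, j, k, l] = 0 from ?_, mul_zero]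
    rcases h with h | h | h | h | h | h
    · exact hzero 3 4 (by decide) a b c h
    · exact hzero 3 5 (by decide) a b c h
    · exact hzero 3 6 (by decide) a b c h
    · exact hzero 4 5 (by decide) a b c h
    · exact hzero 4 6 (by decide) a b c h
    · exact hzero 5 6 (by decide) a b c h
  · rw [← sum_phi_mul_levi_aux i j k l h]
    refine Finset.sum_congr rfl fun a _ => ?_
    split_ifs with ha
    · refine Finset.sum_eq_zero fun b _ => Finset.sum_eq_zero fun c _ => ?_
      rw [show leviSymbol ![a, b, c, i, j, k, l] = 0 from ?_, mul_zero]
      rcases ha with h | h | h | h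
      · exact hzero 0 3 (by decide) a b c h
      · exact hzero 0 4 (by decide) a b c h
      · exact hzero 0 5 (by decide) a b c h
      · exact hzero 0 6 (by decide) a b c h
    refine Finset.sum_congr rfl fun b _ => ?_
    split_ifs with hb
    · refine Finset.sum_eq_zero fun c _ => ?_
      rw [show leviSymbol ![a, b, c, i, j, k, l] = 0 from ?_, mul_zero]
      rcases hb with h | h | h | h
      · exact hzero 1 3 (by decide) a b c h
      · exact hzero 1 4 (by decide) a b c h
      · exact hzero 1 5 (by decide) a b c h
      · exact hzero 1 6 (by decide) a b c h
    refine Finset.sum_congr rfl fun c _ => ?_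
    split_ifs with hc hφ
    · rw [show leviSymbol ![a, b, c, i, j, k, l] = 0 from ?_, mul_zero]
      rcases hc with h | h | h | h
      · exact hzero 2 3 (by decide) a b c h
      · exact hzero 2 4 (by decide) a b c h
      · exact hzero 2 5 (by decide) a b c h
      · exact hzero 2 6 (by decide) a b c h
    · rw [hφ, zero_mul]
    · rfl

/-- Summing out the last three slots produces `6 ψ`, and the remaining contraction gives `24 δ`.
This avoids enumerating the 5040 permutations; after division by 24 it is the normalization `6 g` of
the metric. -/
theorem sum_sign_mul_phi (i j : Fin 7) :
    ∑ σ : Equiv.Perm (Fin 7), (Equiv.Perm.sign σ : ℤ) *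
      (phiSymbol i (σ 0) (σ 1) * phiSymbol j (σ 2) (σ 3) * phiSymbol (σ 4) (σ 5) (σ 6)) =
      144 * delta i j := by
  rw [sum_sign_mul_eq_sum_leviSymbol_mul fun s : Fin 7 → Fin 7 =>
    phiSymbol i (s 0) (s 1) * phiSymbol j (s 2) (s 3) * phiSymbol (s 4) (s 5) (s 6)]
  have h : ∀ a b c d : Fin 7, ∑ e, ∑ p, ∑ q, leviSymbol ![a, b, c, d, e, p, q] *
      (phiSymbol i a b * phiSymbol j c d * phiSymbol e p q) =
      6 * (if phiSymbol i a b = 0 then 0 else if phiSymbol j c d = 0 then 0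
        else phiSymbol i a b * phiSymbol j c d * psiSymbol a b c d) := by
    intro a b c d
    have h6 : 6 * (phiSymbol i a b * phiSymbol j c d * psiSymbol a b c d) =
        phiSymbol i a b * phiSymbol j c d * (6 * psiSymbol a b c d) := by ring
    split_ifs with h1 h2
    · simp [h1]
    · simp [h2]
    · rw [h6, ← sum_phi_mul_levi]
      simp only [Finset.mul_sum]
      refine Finset.sum_congr rfl fun e _ => Finset.sum_congr rfl fun p _ =>
        Finset.sum_congr rfl fun q _ => ?_
      rw [leviSymbol_rotate]
      ring
  calc _ = ∑ a, ∑ b, ∑ c, ∑ d, ∑ e, ∑ p, ∑ q, leviSymbol ![a, b, c, d, e, p, q] *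
      (phiSymbol i a b * phiSymbol j c d * phiSymbol e p q) := by
        simp only [sum_vecCons]
        simp
        rfl
    _ = 6 * ∑ a, ∑ b, (if phiSymbol i a b = 0 then 0 else ∑ c, ∑ d,
          (if phiSymbol j c d = 0 then 0
            else phiSymbol i a b * phiSymbol j c d * psiSymbol a b c d)) := by
        simp only [h, Finset.mul_sum]
        refine Finset.sum_congr rfl fun a _ => Finset.sum_congr rfl fun b _ => ?_
        split_ifs <;> simp [Finset.mul_sum]
    _ = _ := by
        rw [sum_phi_mul_phi_mul_psi_aux]
        ring

/-! ## Wedge products -/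

theorem wedgeSymbol_eq_zero_or (p q r i j k : Fin 7) : wedgeSymbol p q r i j k = 0 ∨
    (i = p ∧ j = q ∧ k = r) ∨ (i = p ∧ j = r ∧ k = q) ∨ (i = q ∧ j = p ∧ k = r) ∨
    (i = q ∧ j = r ∧ k = p) ∨ (i = r ∧ j = p ∧ k = q) ∨ (i = r ∧ j = q ∧ k = p) := by
  have hd (x y z m n o : Fin 7) (h : ¬ (m = x ∧ n = y ∧ o = z)) :
      delta x m * (delta y n * delta z o) = 0 := by
    simp only [delta]
    split_ifs <;> simp_all
  by_contra! h
  obtain ⟨h0, h1, h2, h3, h4, h5, h6⟩ := h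
  apply h0
  have e1 := hd p q r i j k fun ⟨u, v, w⟩ => h1 u v w
  have e2 := hd p q r i k j fun ⟨u, v, w⟩ => h2 u w v
  have e3 := hd p q r j i k fun ⟨u, v, w⟩ => h3 v u w
  have e4 := hd p q r j k i fun ⟨u, v, w⟩ => h5 w u v
  have e5 := hd p q r k i j fun ⟨u, v, w⟩ => h4 v w u
  have e6 := hd p q r k j i fun ⟨u, v, w⟩ => h6 w v u
  rw [wedgeSymbol]
  linear_combination e1 - e2 - e3 + e4 + e5 - e6

/-- The symbol is supported on rearrangements of `(p, q, r)`, where symmetric expressions in the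
indices are constant. It says that each `eᵖ ∧ e^q ∧ eʳ` is an eigenvector of every diagonal tensor
acting by `⋄`. -/
theorem scale_mul_wedgeSymbol (s d : Fin 7 → ℝ) (p q r i j k : Fin 7) :
    (d i + d j + d k) * (s i * s j * s k) * (wedgeSymbol p q r i j k : ℝ) =
      (d p + d q + d r) * (s p * s q * s r) * (wedgeSymbol p q r i j k : ℝ) := by
  rcases wedgeSymbol_eq_zero_or p q r i j k with h | ⟨rfl, rfl, rfl⟩ | ⟨rfl, rfl, rfl⟩ |
    ⟨rfl, rfl, rfl⟩ | ⟨rfl, rfl, rfl⟩ | ⟨rfl, rfl, rfl⟩ | ⟨rfl, rfl, rfl⟩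
  · simp [h]
  all_goals ring

theorem delta_comm (i j : Fin 7) : delta i j = delta j i := by simp only [delta, eq_comm]

theorem basisVec_apply (i k : Fin 7) : basisVec i k = (delta i k : ℝ) := by
  change (Pi.single i 1 : Fin 7 → ℝ) k = _
  rw [Pi.single_apply, delta]
  by_cases h : k = i
  · simp [h]
  · simp [h, Ne.symm h]

theorem coord_apply (i : Fin 7) (x : Heis) : coord i x = x i := rfl

theorem frame_apply (i : Fin 7) (x : Heis) (k : Fin 7) :
    frame i x k = delta i k - (x 0 * delta i 1 + x 2 * delta i 3 + x 4 * delta i 5) *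
      (delta 6 k : ℝ) := by
  rw [frame_eq]
  change basisVec i k - (coord 0 x * coord 1 (basisVec i) + coord 2 x * coord 3 (basisVec i)
      + coord 4 x * coord 5 (basisVec i)) * basisVec 6 k = _
  simp only [coord_apply, basisVec_apply]

theorem coframe_frame (i j : Fin 7) (x : Heis) : coframe i x (frame j x) = delta i j := by
  rw [coframe_apply]
  simp only [frame_apply]
  rw [delta_comm i j]
  by_cases h6 : i = 6
  · subst h6
    simp [delta]
  · have : ¬ (6 = i) := fun h => h6 h.symm
    simp [delta, h6, this]

theorem comp_wedge3 (p q r i j k : Fin 7) (x : Heis) :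
    comp (wedge3 p q r) i j k x = wedgeSymbol p q r i j k := by
  change Matrix.det (Matrix.of fun m : Fin 3 => LinearMap.pi
    ![coframe p x, coframe q x, coframe r x] (![frame i x, frame j x, frame k x] m)) = _
  rw [Matrix.det_fin_three]
  simp [coframe_frame, wedgeSymbol]
  ring

theorem comp_ansatz (f a b c : ℝ → ℝ) (t : ℝ) (i j k : Fin 7) (x : Heis) :
    comp (ansatz f a b c t) i j k x =
      f t * a t ^ 2 * wedgeSymbol 0 1 6 i j k + f t * b t ^ 2 * wedgeSymbol 2 3 6 i j k
      + f t * c t ^ 2 * wedgeSymbol 4 5 6 i j k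
      + a t * b t * c t * (wedgeSymbol 0 2 4 i j k - wedgeSymbol 0 3 5 i j k
        - wedgeSymbol 1 2 5 i j k - wedgeSymbol 1 3 4 i j k) := by
  simp only [← comp_wedge3 _ _ _ i j k x]
  simp only [comp, ansatz, Pi.add_apply, Pi.smul_apply, Pi.sub_apply, AlternatingMap.add_apply,
    AlternatingMap.smul_apply, AlternatingMap.sub_apply, smul_eq_mul]
  ring

theorem comp_standardForm (i j k : Fin 7) (x : Heis) :
    comp standardForm i j k x = phiSymbol i j k := by
  rw [phiSymbol]
  push_cast
  simp only [← comp_wedge3 _ _ _ i j k x]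
  simp only [comp, standardForm, Pi.add_apply, Pi.sub_apply, AlternatingMap.add_apply,
    AlternatingMap.sub_apply]
  ring

/-! ## Structure functions -/

theorem hasFDerivAt_frame (j : Fin 7) (x : Heis) :
    HasFDerivAt (frame j) (-((delta j 1 : ℝ) • coord 0 + (delta j 3 : ℝ) • coord 2
      + (delta j 5 : ℝ) • coord 4).smulRight (basisVec 6)) x := by
  have h : frame j = fun y => basisVec j + (-((delta j 1 : ℝ) • coord 0 + (delta j 3 : ℝ) • coord 2
      + (delta j 5 : ℝ) • coord 4).smulRight (basisVec 6)) y := by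
    funext y
    rw [frame_eq]
    simp only [coord_apply, basisVec_apply]
    simp only [_root_.neg_apply, ContinuousLinearMap.smulRight_apply,
      _root_.add_apply, _root_.smul_apply, coord_apply, smul_eq_mul,
      sub_eq_add_neg]
    congr 3
    ring
  rw [h]
  exact (ContinuousLinearMap.hasFDerivAt _).const_add _

theorem coframe_basisVec_six (k : Fin 7) (x : Heis) : coframe k x (basisVec 6) = delta 6 k := by
  rw [coframe_apply]
  simp [basisVec_apply, delta]

theorem structFun_eq (i j k : Fin 7) (x : Heis) :
    structFun i j k x = ∑ u, (structSymbol u i j k : ℝ) := by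
  rw [structFun, VectorField.lieBracket, (hasFDerivAt_frame i x).fderiv,
    (hasFDerivAt_frame j x).fderiv]
  simp only [_root_.neg_apply, ContinuousLinearMap.smulRight_apply,
      _root_.add_apply, _root_.smul_apply, coord_apply, smul_eq_mul,
      map_sub, map_neg, map_smul, coframe_basisVec_six, frame_apply]
  rw [Fin.sum_univ_three]
  simp only [structSymbol, delta_comm j, delta_comm i, Matrix.cons_val,
    show delta 6 0 = 0 from rfl, show delta 6 2 = 0 from rfl, show delta 6 4 = 0 from rfl]
  push_cast
  ring

/-! ## Tensors of an invariant structure with orthonormal coframe `s i • eⁱ` -/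

/-- The metric with orthonormal coframe `s i • eⁱ`. -/
def diagMetric (s : Fin 7 → ℝ) : MetricField := fun _ => Matrix.diagonal fun i => s i ^ 2

/-- The volume form of the coframe `s i • eⁱ`. -/
def volCoeff (s : Fin 7 → ℝ) : Heis → ℝ := fun _ => ∏ i, s i

/-- `φ` is the model form in the coframe `s i • eⁱ`, whose structure constants are `w`. -/
structure IsModel (φ : ThreeForm) (s : Fin 7 → ℝ) (w : Fin 3 → ℝ) : Prop where
  scale_ne_zero : ∀ i, s i ≠ 0
  comp_eq : ∀ i j k x, comp φ i j k x = s i * s j * s k * phiSymbol i j k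
  struct_mul : ∀ u i j k, structSymbol u i j k * s k = w u * (s i * s j) * structSymbol u i j k

theorem diagMetric_apply (s : Fin 7 → ℝ) (x : Heis) (i j : Fin 7) :
    diagMetric s x i j = if i = j then s i ^ 2 else 0 := by
  rw [diagMetric, Matrix.diagonal_apply]

theorem diagMetric_det (s : Fin 7 → ℝ) (x : Heis) : (diagMetric s x).det = volCoeff s x ^ 2 := by
  rw [diagMetric, Matrix.det_diagonal, volCoeff, Finset.prod_pow]

theorem frameDeriv_const (i : Fin 7) (r : ℝ) (x : Heis) : frameDeriv i (fun _ => r) x = 0 := by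
  simp [frameDeriv]

namespace IsModel

variable {φ : ThreeForm} {s : Fin 7 → ℝ} {w : Fin 3 → ℝ}

theorem inv_diagMetric_apply (h : IsModel φ s w) (x : Heis) (i j : Fin 7) :
    (diagMetric s x)⁻¹ i j = if i = j then (s i ^ 2)⁻¹ else 0 := by
  have : (diagMetric s x)⁻¹ = Matrix.diagonal fun i => (s i ^ 2)⁻¹ := by
    refine Matrix.inv_eq_right_inv ?_
    rw [diagMetric, Matrix.diagonal_mul_diagonal, ← Matrix.diagonal_one]
    congr 1
    funext i
    exact mul_inv_cancel₀ (pow_ne_zero 2 (h.scale_ne_zero i))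
  rw [this, Matrix.diagonal_apply]

theorem contractionForm_eq (h : IsModel φ s w) (i j : Fin 7) (x : Heis) :
    contractionForm φ i j x = 6 * diagMetric s x i j * volCoeff s x := by
  have hsum := congrArg (Int.cast : ℤ → ℝ) (sum_sign_mul_phi i j)
  push_cast at hsum
  have hterm (σ : Equiv.Perm (Fin 7)) : ((Equiv.Perm.sign σ : ℤ) : ℝ) *
      (comp φ i (σ 0) (σ 1) x * comp φ j (σ 2) (σ 3) x * comp φ (σ 4) (σ 5) (σ 6) x) =
      s i * s j * volCoeff s x * (((Equiv.Perm.sign σ : ℤ) : ℝ) *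
        (phiSymbol i (σ 0) (σ 1) * phiSymbol j (σ 2) (σ 3) * phiSymbol (σ 4) (σ 5) (σ 6))) := by
    rw [volCoeff, ← Equiv.prod_comp σ s, Fin.prod_univ_seven]
    simp only [h.comp_eq]
    ring
  rw [contractionForm, Finset.sum_congr rfl fun σ _ => hterm σ, ← Finset.mul_sum, hsum,
    diagMetric_apply, delta]
  split_ifs with hij
  · subst hij
    push_cast
    ring
  · simp

theorem volCoeff_ne_zero (h : IsModel φ s w) (x : Heis) : volCoeff s x ≠ 0 :=
  Finset.prod_ne_zero_iff.2 fun i _ => h.scale_ne_zero i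

theorem isG2Structure (h : IsModel φ s w) : IsG2Structure φ (diagMetric s) (volCoeff s) where
  smooth i j k := by
    rw [show comp φ i j k = fun _ => s i * s j * s k * phiSymbol i j k from
      funext fun x => h.comp_eq i j k x]
    exact contDiff_const
  posDef _ := Matrix.PosDef.diagonal fun i => sq_pos_of_ne_zero (h.scale_ne_zero i)
  vol_sq x := (diagMetric_det s x).symm
  contraction := h.contractionForm_eq

/-- The metric and the volume form are determined by the 3-form. -/
theorem eq_of_isG2Structure (h : IsModel φ s w) {g : MetricField} {v : Heis → ℝ}
    (hg : IsG2Structure φ g v) : g = diagMetric s ∧ v = volCoeff s := by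
  have hmat (x : Heis) : v x • g x = volCoeff s x • diagMetric s x := by
    ext i j
    have := (hg.contraction i j x).symm.trans (h.contractionForm_eq i j x)
    simp only [Matrix.smul_apply, smul_eq_mul]
    linarith
  have hv (x : Heis) : v x = volCoeff s x := by
    have hdet := congrArg Matrix.det (hmat x)
    rw [Matrix.det_smul, Matrix.det_smul, ← hg.vol_sq, diagMetric_det, Fintype.card_fin,
      ← pow_add, ← pow_add] at hdet
    -- Here 7 comes from scaling a determinant in dimension seven and 2 from `det g = v ^ 2`. As the
    -- total exponent is odd, the sign of `v` is determined too.
    exact (Odd.strictMono_pow (by decide : Odd (7 + 2))).injective hdet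
  refine ⟨funext fun x => ?_, funext hv⟩
  have := hmat x
  rw [hv x] at this
  exact smul_right_injective _ (h.volCoeff_ne_zero x) this

/-- Raising three indices turns `s a * s b * s c` into its inverse. Where the Levi-Civita symbol is
nonzero, the volume factor is the product of the scales over all seven slots, so exactly the four
free ones remain. -/
theorem hodgeDual_eq (h : IsModel φ s w) (i j k l : Fin 7) (x : Heis) :
    hodgeDual (diagMetric s) (volCoeff s) φ i j k l x =
      s i * s j * s k * s l * psiSymbol i j k l := by
  have hsum := congrArg (Int.cast : ℤ → ℝ) (sum_phi_mul_levi i j k l)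
  push_cast at hsum
  have hterm (a b c : Fin 7) :
      (∑ p, ∑ q, ∑ r, (diagMetric s x)⁻¹ a p * (diagMetric s x)⁻¹ b q * (diagMetric s x)⁻¹ c r *
        comp φ p q r x) * (volCoeff s x * leviCivita ![a, b, c, i, j, k, l]) =
      s i * s j * s k * s l * (phiSymbol a b c * leviSymbol ![a, b, c, i, j, k, l]) := by
    have hprod := prod_mul_leviSymbol s ![a, b, c, i, j, k, l]
    rw [Fin.prod_univ_seven (fun m => s (![a, b, c, i, j, k, l] m))] at hprod
    simp only [Matrix.cons_val] at hprod
    rw [leviCivita_eq, volCoeff, hprod]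
    simp only [h.inv_diagMetric_apply, h.comp_eq, ite_mul, mul_ite, zero_mul, mul_zero,
      Finset.sum_ite_eq, Finset.mem_univ, if_true]
    have ha := h.scale_ne_zero a
    have hb := h.scale_ne_zero b
    have hc := h.scale_ne_zero c
    field_simp
  simp only [hodgeDual, hterm, ← Finset.mul_sum, hsum]
  ring

/-- The metric is constant in the frame, so only the bracket terms of the Koszul formula contribute;
`struct_mul` rewrites them in terms of `w`. -/
theorem connection_eq (h : IsModel φ s w) (i j l : Fin 7) (x : Heis) :
    connection (diagMetric s) i j l x =
      s i * s j / s l * (1 / 2 * ∑ u, w u * connSymbol u i j l) := by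
  simp only [connection, diagMetric_apply, h.inv_diagMetric_apply, frameDeriv_const, structFun_eq,
    ite_mul, mul_ite, zero_mul, mul_zero, Finset.sum_sub_distrib,
    Finset.sum_ite_eq, Finset.sum_ite_eq', Finset.mem_univ, if_true]
  have hi := h.scale_ne_zero i
  have hj := h.scale_ne_zero j
  have hl := h.scale_ne_zero l
  simp only [Fin.sum_univ_three, connSymbol]
  push_cast
  field_simp
  linear_combination
    s l * (h.struct_mul 0 i j l + h.struct_mul 1 i j l + h.struct_mul 2 i j l)
    - s j * (h.struct_mul 0 i l j + h.struct_mul 1 i l j + h.struct_mul 2 i l j)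
    - s i * (h.struct_mul 0 j l i + h.struct_mul 1 j l i + h.struct_mul 2 j l i)

theorem connection_eq_fun (h : IsModel φ s w) (i j l : Fin 7) :
    connection (diagMetric s) i j l =
      fun _ => s i * s j / s l * (1 / 2 * ∑ u, w u * connSymbol u i j l) :=
  funext fun x => h.connection_eq i j l x

end IsModel

/-! ## Torsion -/

/-- Diagonal of the torsion in the orthonormal frame. -/
def torsionDiag (w : Fin 3 → ℝ) (i : Fin 7) : ℝ := 1 / 2 * ∑ u, w u * torsionSymbol u i

/-- The torsion tensor of the model form. -/
def modelTorsion (s : Fin 7 → ℝ) (w : Fin 3 → ℝ) : TwoTensor := fun i j _ =>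
  if i = j then s i ^ 2 * torsionDiag w i else 0

/-- Diagonal of the Ricci tensor in the orthonormal frame. -/
def ricciDiag (w : Fin 3 → ℝ) (i : Fin 7) : ℝ := 1 / 2 * ∑ u, w u ^ 2 * ricciSymbol u i

/-- Diagonal of `-Ric + 3 Tᵗ T - |T|² g` in the orthonormal frame. -/
def flowDiag (w : Fin 3 → ℝ) (i : Fin 7) : ℝ :=
  -ricciDiag w i + 3 * torsionDiag w i ^ 2 - ∑ j, torsionDiag w j ^ 2

namespace IsModel

variable {φ : ThreeForm} {s : Fin 7 → ℝ} {w : Fin 3 → ℝ}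

theorem covDeriv3_eq (h : IsModel φ s w) (m i j k : Fin 7) (x : Heis) :
    covDeriv3 (diagMetric s) φ m i j k x =
      s m * s i * s j * s k * (torsionDiag w m * psiSymbol m i j k) := by
  have hcomp : comp φ i j k = fun _ => s i * s j * s k * phiSymbol i j k :=
    funext fun x => h.comp_eq i j k x
  have hu (u : Fin 3) := congrArg (Int.cast : ℤ → ℝ) (torsion_symbol_identity u m i j k)
  push_cast at hu
  have hterm (p : Fin 7) :
      connection (diagMetric s) m i p x * comp φ p j k x
        + connection (diagMetric s) m j p x * comp φ i p k x
        + connection (diagMetric s) m k p x * comp φ i j p x =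
      ∑ u, s m * s i * s j * s k * (1 / 2 * w u) *
        (connSymbol u m i p * phiSymbol p j k + connSymbol u m j p * phiSymbol i p k
          + connSymbol u m k p * phiSymbol i j p) := by
    have hp := h.scale_ne_zero p
    simp only [h.connection_eq, h.comp_eq, Fin.sum_univ_three]
    field_simp
    ring
  rw [covDeriv3, hcomp, frameDeriv_const, Finset.sum_congr rfl fun p _ => hterm p,
    Finset.sum_comm]
  simp only [← Finset.mul_sum, torsionDiag, Fin.sum_univ_three]
  linear_combination s m * s i * s j * s k * (1 / 2) * (w 0 * hu 0 + w 1 * hu 1 + w 2 * hu 2)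

/-- Uniqueness holds because contraction with `ψ` is injective on vectors: `exists_psiSymbol_eq_one`
isolates each component of `T`. -/
theorem isTorsion_iff (h : IsModel φ s w) (T : TwoTensor) :
    IsTorsion (diagMetric s) (volCoeff s) φ T ↔ T = modelTorsion s w := by
  simp only [IsTorsion, h.covDeriv3_eq, h.hodgeDual_eq, h.inv_diagMetric_apply, mul_ite, mul_zero,
    Finset.sum_ite_eq', Finset.mem_univ, if_true]
  constructor
  · intro hT
    funext m p x
    obtain ⟨i, j, k, hp, hq⟩ := exists_psiSymbol_eq_one p
    have key := hT m i j k x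
    rw [Finset.sum_eq_single p (fun q _ hqp => by simp [hq q hqp]) (by simp), hp] at key
    have hsp := h.scale_ne_zero p
    have hi := h.scale_ne_zero i
    have hj := h.scale_ne_zero j
    have hk := h.scale_ne_zero k
    rw [modelTorsion]
    split_ifs with hmp
    · subst hmp
      rw [hp] at key
      field_simp at key
      linarith
    · rw [hq m hmp] at key
      simpa [hsp, hi, hj, hk] using key.symm
  · rintro rfl m i j k x
    have hm := h.scale_ne_zero m
    simp only [modelTorsion, ite_mul, zero_mul, Finset.sum_ite_eq, Finset.mem_univ, if_true]
    field_simp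

/-- The tensor is diagonal with constant entries, so only the coefficients `Γⱼⱼᵖ` and `Γⱼᵢʲ` enter,
and these vanish. -/
theorem divergence_eq_zero (h : IsModel φ s w) (i : Fin 7) (x : Heis) :
    divergence (diagMetric s) (modelTorsion s w) i x = 0 := by
  have hconst (j i : Fin 7) :
      modelTorsion s w j i = fun _ => if j = i then s j ^ 2 * torsionDiag w j else 0 := rfl
  simp only [divergence, covDeriv2, h.inv_diagMetric_apply, ite_mul, zero_mul, Finset.sum_ite_eq,
    Finset.mem_univ, if_true]
  refine Finset.sum_eq_zero fun j _ => ?_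
  rw [hconst j i, frameDeriv_const]
  simp only [modelTorsion, mul_ite, mul_zero, Finset.sum_add_distrib, Finset.sum_ite_eq,
    Finset.sum_ite_eq', Finset.mem_univ, if_true, h.connection_eq, connSymbol_self_left,
    connSymbol_self_right]
  simp

/-! ### Ricci tensor and velocity of the flow. -/

theorem ricci_eq (h : IsModel φ s w) (j k : Fin 7) (x : Heis) :
    ricci (diagMetric s) j k x = if j = k then s j ^ 2 * ricciDiag w j else 0 := by
  have huv (u v : Fin 3) := congrArg (Int.cast : ℤ → ℝ) (ricci_symbol_identity u v j k)
  push_cast at huv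
  have hterm (i p : Fin 7) :
      connection (diagMetric s) j k p x * connection (diagMetric s) i p i x
        - connection (diagMetric s) i k p x * connection (diagMetric s) j p i x
        - structFun i j p x * connection (diagMetric s) p k i x =
      ∑ u, ∑ v, s j * s k * (1 / 4 * (w u * w v)) *
        (connSymbol u j k p * connSymbol v i p i - connSymbol u i k p * connSymbol v j p i
          - 2 * (structSymbol u i j p * connSymbol v p k i)) := by
    have hi := h.scale_ne_zero i
    have hp := h.scale_ne_zero p
    have hstruct : structFun i j p x = s i * s j / s p * ∑ u, w u * structSymbol u i j p := by
      rw [structFun_eq, Fin.sum_univ_three, Fin.sum_univ_three]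
      field_simp
      linear_combination h.struct_mul 0 i j p + h.struct_mul 1 i j p + h.struct_mul 2 i j p
    simp only [h.connection_eq, hstruct, Fin.sum_univ_three]
    field_simp
    ring
  have hriem (i : Fin 7) : riemann (diagMetric s) i j k i x =
      ∑ p, ∑ u, ∑ v, s j * s k * (1 / 4 * (w u * w v)) *
        (connSymbol u j k p * connSymbol v i p i - connSymbol u i k p * connSymbol v j p i
          - 2 * (structSymbol u i j p * connSymbol v p k i)) := by
    rw [riemann, Finset.sum_congr rfl fun p _ => hterm i p, h.connection_eq_fun j k i,
      h.connection_eq_fun i k i, frameDeriv_const, frameDeriv_const, sub_zero, zero_add]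
  have hsum : ricci (diagMetric s) j k x = ∑ u, ∑ v, s j * s k * (1 / 4 * (w u * w v)) *
      (if u = v ∧ j = k then 2 * ricciSymbol u j else 0 : ℝ) := by
    simp only [ricci, hriem, ← huv, Finset.mul_sum]
    simp only [Finset.sum_comm (s := (Finset.univ : Finset (Fin 7)))
      (t := (Finset.univ : Finset (Fin 3)))]
  rw [hsum]
  split_ifs with hjk
  · subst hjk
    simp [Fin.sum_univ_three, ricciDiag]
    ring
  · simp [hjk]

theorem flowTensor_eq (h : IsModel φ s w) (i j : Fin 7) (x : Heis) :
    flowTensor (diagMetric s) (modelTorsion s w) i j x =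
      if i = j then s i ^ 2 * flowDiag w i else 0 := by
  have hnorm : normSq (diagMetric s) (modelTorsion s w) x = ∑ j, torsionDiag w j ^ 2 := by
    simp only [normSq, h.inv_diagMetric_apply, modelTorsion, ite_mul, mul_ite, zero_mul, mul_zero,
      Finset.sum_ite_eq, Finset.mem_univ, if_true]
    refine Finset.sum_congr rfl fun m _ => ?_
    have hm := h.scale_ne_zero m
    rw [Finset.sum_eq_single m (fun k _ hk => by simp [hk.symm]) (by simp),
      Finset.sum_eq_single m (fun l _ hl => by simp [hl.symm]) (by simp)]
    simp only [if_true]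
    field_simp
  have htt : transposeMul (diagMetric s) (modelTorsion s w) i j x =
      if i = j then s i ^ 2 * torsionDiag w i ^ 2 else 0 := by
    have hi := h.scale_ne_zero i
    simp only [transposeMul, h.inv_diagMetric_apply, modelTorsion, ite_mul, mul_ite, zero_mul,
      mul_zero, Finset.sum_ite_eq', Finset.mem_univ, if_true]
    by_cases hij : i = j
    · subst hij
      simp only [if_true]
      field_simp
    · simp [hij, Ne.symm hij]
  rw [flowTensor, hnorm, htt, h.ricci_eq, diagMetric_apply, flowDiag]
  split_ifs <;> ring

theorem flowVelocity_eq (h : IsModel φ s w) (i j k : Fin 7) (x : Heis) :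
    flowVelocity (diagMetric s) (volCoeff s) φ (modelTorsion s w) i j k x =
      (flowDiag w i + flowDiag w j + flowDiag w k) * (s i * s j * s k) * phiSymbol i j k := by
  have hi := h.scale_ne_zero i
  have hj := h.scale_ne_zero j
  have hk := h.scale_ne_zero k
  simp only [flowVelocity, diamond, h.divergence_eq_zero, h.flowTensor_eq, h.inv_diagMetric_apply,
    h.comp_eq, zero_mul, ite_mul, mul_ite, mul_zero, Finset.sum_const_zero, add_zero,
    Finset.sum_add_distrib, Finset.sum_ite_eq, Finset.sum_ite_eq', Finset.mem_univ, if_true]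
  field_simp

end IsModel

/-! ## The diagonal family -/

/-- Scales of the orthonormal coframe of the diagonal family. -/
def diagScale (a b c f : ℝ) : Fin 7 → ℝ := ![a, a, b, b, c, c, f]

/-- Structure constants of the orthonormal coframe of the diagonal family. -/
def diagStruct (a b c f : ℝ) : Fin 3 → ℝ := ![f / a ^ 2, f / b ^ 2, f / c ^ 2]

/-- With `d` the diagonal of the flow tensor, this says that the velocity is tangent to the ansatz:
the seven eigenvalues `d p + d q + d r` collapse to four. -/
theorem diagScale_mul_phiSymbol (a b c f : ℝ) (d : Fin 7 → ℝ) (h1 : d 1 = d 0) (h3 : d 3 = d 2)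
    (h5 : d 5 = d 4) (i j k : Fin 7) :
    (d i + d j + d k) * (diagScale a b c f i * diagScale a b c f j * diagScale a b c f k) *
      (phiSymbol i j k : ℝ) =
    (2 * d 0 + d 6) * (f * a ^ 2) * wedgeSymbol 0 1 6 i j k
      + (2 * d 2 + d 6) * (f * b ^ 2) * wedgeSymbol 2 3 6 i j k
      + (2 * d 4 + d 6) * (f * c ^ 2) * wedgeSymbol 4 5 6 i j k
      + (d 0 + d 2 + d 4) * (a * b * c) * (wedgeSymbol 0 2 4 i j k - wedgeSymbol 0 3 5 i j k
        - wedgeSymbol 1 2 5 i j k - wedgeSymbol 1 3 4 i j k) := by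
  have key (p q r : Fin 7) := scale_mul_wedgeSymbol (diagScale a b c f) d p q r i j k
  have e1 := key 0 1 6
  have e2 := key 2 3 6
  have e3 := key 4 5 6
  have e4 := key 0 2 4
  have e5 := key 0 3 5
  have e6 := key 1 2 5
  have e7 := key 1 3 4
  simp only [show diagScale a b c f 0 = a from rfl, show diagScale a b c f 1 = a from rfl,
    show diagScale a b c f 2 = b from rfl, show diagScale a b c f 3 = b from rfl,
    show diagScale a b c f 4 = c from rfl, show diagScale a b c f 5 = c from rfl,
    show diagScale a b c f 6 = f from rfl, h1, h3, h5] at e1 e2 e3 e4 e5 e6 e7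
  rw [phiSymbol]
  push_cast
  linear_combination e1 + e2 + e3 + e4 - e5 - e6 - e7

theorem structSymbol_mul_diagScale {a b c : ℝ} (f : ℝ) (ha : a ≠ 0) (hb : b ≠ 0) (hc : c ≠ 0)
    (u : Fin 3) (i j k : Fin 7) :
    structSymbol u i j k * diagScale a b c f k =
      diagStruct a b c f u * (diagScale a b c f i * diagScale a b c f j) *
        structSymbol u i j k := by
  by_cases hk : 6 = k
  · subst hk
    have key (p q : Fin 7) (r : ℝ) (hr : r ≠ 0) (hp : diagScale a b c f p = r)
        (hq : diagScale a b c f q = r) :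
        ((delta p j * delta q i - delta p i * delta q j : ℤ) : ℝ) * f =
          f / r ^ 2 * (diagScale a b c f i * diagScale a b c f j) *
          ((delta p j * delta q i - delta p i * delta q j : ℤ) : ℝ) := by
      have hd (x y : Fin 7) : (delta x y : ℝ) * diagScale a b c f y =
          diagScale a b c f x * delta x y := by
        simp only [delta]
        split_ifs with hxy
        · simp [hxy]
        · simp
      have e1 := hd p j
      have e2 := hd q i
      have e3 := hd p i
      have e4 := hd q j
      rw [hp] at e1 e3
      rw [hq] at e2 e4
      push_cast
      field_simp
      linear_combination (-f) * (diagScale a b c f i * delta q i) * e1 - f * r * delta p j * e2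
        + f * (diagScale a b c f j * delta q j) * e3 + f * r * delta p i * e4
    have h6 : diagScale a b c f 6 = f := rfl
    rw [h6]
    simp only [structSymbol, show delta 6 6 = 1 from rfl, one_mul]
    fin_cases u
    · exact key 0 1 a ha rfl rfl
    · exact key 2 3 b hb rfl rfl
    · exact key 4 5 c hc rfl rfl
  · simp [structSymbol, delta, hk]

theorem isModel_ansatz {f a b c : ℝ → ℝ} {t : ℝ} (hf : f t ≠ 0) (ha : a t ≠ 0) (hb : b t ≠ 0)
    (hc : c t ≠ 0) :
    IsModel (ansatz f a b c t) (diagScale (a t) (b t) (c t) (f t))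
      (diagStruct (a t) (b t) (c t) (f t)) where
  scale_ne_zero i := by fin_cases i <;> assumption
  comp_eq i j k x := by
    -- The constant `1 / 3` makes every sum of three diagonal entries equal to 1, leaving the bare
    -- scaling of the components.
    have h := diagScale_mul_phiSymbol (a t) (b t) (c t) (f t) (fun _ => 1 / 3) rfl rfl rfl i j k
    rw [comp_ansatz]
    linear_combination -h
  struct_mul := structSymbol_mul_diagScale (f t) ha hb hc

theorem flowDiag_diagStruct (a b c f : ℝ) :
    flowDiag (diagStruct a b c f) 1 = flowDiag (diagStruct a b c f) 0 ∧
    flowDiag (diagStruct a b c f) 3 = flowDiag (diagStruct a b c f) 2 ∧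
    flowDiag (diagStruct a b c f) 5 = flowDiag (diagStruct a b c f) 4 := by
  simp [flowDiag, ricciDiag, torsionDiag, ricciSymbol, torsionSymbol]

/-- Velocities of `f a²`, `f b²`, `f c²` and `a b c` under the flow. -/
theorem flowDiag_velocities {a b c : ℝ} (f : ℝ) (ha : a ≠ 0) (hb : b ≠ 0) (hc : c ≠ 0) :
    (2 * flowDiag (diagStruct a b c f) 0 + flowDiag (diagStruct a b c f) 6) * (f * a ^ 2) =
      -(f ^ 3 * (4 * a ^ 4 * (b ^ 4 + c ^ 4) - b ^ 4 * c ^ 4) / (2 * a ^ 2 * b ^ 4 * c ^ 4)) ∧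
    (2 * flowDiag (diagStruct a b c f) 2 + flowDiag (diagStruct a b c f) 6) * (f * b ^ 2) =
      -(f ^ 3 * (4 * b ^ 4 * (a ^ 4 + c ^ 4) - a ^ 4 * c ^ 4) / (2 * a ^ 4 * b ^ 2 * c ^ 4)) ∧
    (2 * flowDiag (diagStruct a b c f) 4 + flowDiag (diagStruct a b c f) 6) * (f * c ^ 2) =
      -(f ^ 3 * (4 * c ^ 4 * (a ^ 4 + b ^ 4) - a ^ 4 * b ^ 4) / (2 * a ^ 4 * b ^ 4 * c ^ 2)) ∧
    (flowDiag (diagStruct a b c f) 0 + flowDiag (diagStruct a b c f) 2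
        + flowDiag (diagStruct a b c f) 4) * (a * b * c) =
      -(f ^ 2 * (3 * (a * b * c) ^ 2 * (a ^ 2 + b ^ 2 + c ^ 2)
          + 2 * (a ^ 4 * b ^ 4 + a ^ 4 * c ^ 4 + b ^ 4 * c ^ 4))
        / (2 * a ^ 3 * b ^ 3 * c ^ 3)) := by
  simp only [flowDiag, ricciDiag, torsionDiag, ricciSymbol, torsionSymbol, diagStruct,
    Fin.sum_univ_seven, Fin.sum_univ_three, Matrix.cons_val]
  push_cast
  refine ⟨?_, ?_, ?_, ?_⟩ <;> field_simp <;> ring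

theorem ansatz_eq_standardForm_iff {f a b c : ℝ → ℝ} {t : ℝ} (ha : 0 < a t) (hb : 0 < b t)
    (hc : 0 < c t) :
    ansatz f a b c t = standardForm ↔ f t = 1 ∧ a t = 1 ∧ b t = 1 ∧ c t = 1 := by
  constructor
  · intro h
    have hcomp (i j k : Fin 7) := (comp_ansatz f a b c t i j k 0).symm.trans
      ((congrArg (fun φ => comp φ i j k 0) h).trans (comp_standardForm i j k 0))
    have h1 : f t * a t ^ 2 = 1 := by
      simpa [wedgeSymbol, phiSymbol, delta] using hcomp 0 1 6
    have h2 : f t * b t ^ 2 = 1 := by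
      simpa [wedgeSymbol, phiSymbol, delta] using hcomp 2 3 6
    have h3 : f t * c t ^ 2 = 1 := by
      simpa [wedgeSymbol, phiSymbol, delta] using hcomp 4 5 6
    have h4 : a t * b t * c t = 1 := by
      simpa [wedgeSymbol, phiSymbol, delta] using hcomp 0 2 4
    have hf : f t ≠ 0 := by
      rintro h0
      simp [h0] at h1
    -- Only squares are known to agree, so positivity is what excludes opposite signs.
    have hab : a t = b t := (pow_left_inj₀ ha.le hb.le two_ne_zero).1
      (mul_left_cancel₀ hf (h1.trans h2.symm))
    have hac : a t = c t := (pow_left_inj₀ ha.le hc.le two_ne_zero).1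
      (mul_left_cancel₀ hf (h1.trans h3.symm))
    have ha1 : a t = 1 := by
      rw [← hab, ← hac] at h4
      exact (pow_eq_one_iff_of_nonneg ha.le three_ne_zero).1 (by linear_combination h4)
    refine ⟨?_, ha1, hab ▸ ha1, hac ▸ ha1⟩
    simpa [ha1] using h1
  · rintro ⟨hf, ha, hb, hc⟩
    simp [ansatz, standardForm, hf, ha, hb, hc]
    abel

/-! ### Reduction of the flow to the four coefficient functions. -/

theorem hasDerivWithinAt_comp_ansatz_iff {I : Set ℝ} {f a b c : ℝ → ℝ} {t : ℝ}
    (A B C D : ℝ) :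
    (∀ i j k x, HasDerivWithinAt (fun s => comp (ansatz f a b c s) i j k x)
      (A * wedgeSymbol 0 1 6 i j k + B * wedgeSymbol 2 3 6 i j k + C * wedgeSymbol 4 5 6 i j k
        + D * (wedgeSymbol 0 2 4 i j k - wedgeSymbol 0 3 5 i j k
        - wedgeSymbol 1 2 5 i j k - wedgeSymbol 1 3 4 i j k)) I t) ↔
    HasDerivWithinAt (fun s => f s * a s ^ 2) A I t ∧
    HasDerivWithinAt (fun s => f s * b s ^ 2) B I t ∧
    HasDerivWithinAt (fun s => f s * c s ^ 2) C I t ∧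
    HasDerivWithinAt (fun s => a s * b s * c s) D I t := by
  simp only [comp_ansatz]
  constructor
  · intro h
    refine ⟨?_, ?_, ?_, ?_⟩
    · simpa [wedgeSymbol, delta] using h 0 1 6 0
    · simpa [wedgeSymbol, delta] using h 2 3 6 0
    · simpa [wedgeSymbol, delta] using h 4 5 6 0
    · simpa [wedgeSymbol, delta] using h 0 2 4 0
  · rintro ⟨hA, hB, hC, hD⟩ i j k x
    exact (((hA.mul_const _).add (hB.mul_const _)).add (hC.mul_const _)).add (hD.mul_const _)

/-- The existential quantifiers disappear because `φ` determines its metric, volume form and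
torsion. -/
theorem flow_at_iff {I : Set ℝ} {f a b c : ℝ → ℝ} {t : ℝ} (hf : f t ≠ 0) (ha : a t ≠ 0)
    (hb : b t ≠ 0) (hc : c t ≠ 0) :
    (∃ (g : MetricField) (v : Heis → ℝ) (T : TwoTensor),
      IsG2Structure (ansatz f a b c t) g v ∧ IsTorsion g v (ansatz f a b c t) T ∧
        ∀ i j k x, HasDerivWithinAt (fun s => comp (ansatz f a b c s) i j k x)
          (flowVelocity g v (ansatz f a b c t) T i j k x) I t) ↔
    ∀ i j k x, HasDerivWithinAt (fun s => comp (ansatz f a b c s) i j k x)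
      (flowVelocity (diagMetric (diagScale (a t) (b t) (c t) (f t)))
        (volCoeff (diagScale (a t) (b t) (c t) (f t))) (ansatz f a b c t)
        (modelTorsion (diagScale (a t) (b t) (c t) (f t)) (diagStruct (a t) (b t) (c t) (f t)))
        i j k x) I t := by
  have h := isModel_ansatz hf ha hb hc
  constructor
  · rintro ⟨g, v, T, hg, hT, hd⟩
    obtain ⟨rfl, rfl⟩ := h.eq_of_isG2Structure hg
    obtain rfl := (h.isTorsion_iff T).1 hT
    exact hd
  · exact fun hd => ⟨_, _, _, h.isG2Structure, (h.isTorsion_iff _).2 rfl, hd⟩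

end HeisenbergG2

end

theorem theorem4p4 (I : Set ℝ) (hI : I.OrdConnected) (hI2 : I.Nontrivial) (h0 : (0 : ℝ) ∈ I)
    (f a b c : ℝ → ℝ)
    (hf : ∀ t ∈ I, f t ≠ 0) (ha : ∀ t ∈ I, a t ≠ 0)
    (hb : ∀ t ∈ I, b t ≠ 0) (hc : ∀ t ∈ I, c t ≠ 0)
    (ha0 : 0 < a 0) (hb0 : 0 < b 0) (hc0 : 0 < c 0) :
    HeisenbergG2.SolvesRicciHarmonicFlow I HeisenbergG2.standardForm
        (HeisenbergG2.ansatz f a b c) ↔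
      (f 0 = 1 ∧ a 0 = 1 ∧ b 0 = 1 ∧ c 0 = 1) ∧ HeisenbergG2.SolvesODE I f a b c := by
  refine and_congr (HeisenbergG2.ansatz_eq_standardForm_iff ha0 hb0 hc0)
    (forall₂_congr fun t ht => ?_)
  rw [HeisenbergG2.flow_at_iff (hf t ht) (ha t ht) (hb t ht) (hc t ht)]
  obtain ⟨h1, h3, h5⟩ := HeisenbergG2.flowDiag_diagStruct (a t) (b t) (c t) (f t)
  obtain ⟨eA, eB, eC, eD⟩ :=
    HeisenbergG2.flowDiag_velocities (f t) (ha t ht) (hb t ht) (hc t ht)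
  -- The right-hand sides of the system are turned back into eigenvalues of the flow tensor, so that
  -- both sides become the same statement about components.
  rw [← eA, ← eB, ← eC, ← eD, ← HeisenbergG2.hasDerivWithinAt_comp_ansatz_iff]
  simp only [(HeisenbergG2.isModel_ansatz (hf t ht) (ha t ht) (hb t ht) (hc t ht)).flowVelocity_eq,
    HeisenbergG2.diagScale_mul_phiSymbol _ _ _ _ _ h1 h3 h5]
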